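/- Let $q\ge 6$ be a prime power. For $1\le r\le 6$, an $r$-dimensional normal rational curve of $\mathrm{PG}(6,q)$ is a set of points lying in an $r$-dimensional subspace in which, with respect to suitable homogeneous coordinates, it is $$\{(x^r,x^{r-1}y,\dots,xy^{r-1},y^r) : (x,y)\in\mathbb F_q^2\setminus\{(0,0)\}\};$$ $(x,y)$ is the parameter of the point. For $r=2$ this is a non-degenerate conic, for $r=3$ a twisted cubic. In $\mathrm{PG}(6,q)$, let $\mathcal C$ be a non-degenerate conic in a plane $\alpha$ and let $\mathcal N_3$ be a twisted cubic in a $3$-space $\Pi_3$ with $\alpha\cap\Pi_3=\emptyset$. Let $\phi$ be a projectivity from the points of $\mathcal C$ to the points of $\mathcal N_3$, that is, a map which in terms of the parameters on $\mathcal C$ and $\mathcal N_3$ is an element of $\mathrm{PGL}(2,q)$. Let $\mathcal V$ be the ruled quintic surface consisting of all points on the $q+1$ lines joining a point $P\in\mathcal C$ to $\phi(P)$; these lines are called the generators of $\mathcal V$. Let $r\in\{3,4,5\}$ and let $\mathcal N_r$ be an $r$-dimensional normal rational curve all of whose points lie on $\mathcal V$. Then $\mathcal N_r$ contains exactly one point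 on each generator of $\mathcal V$. -/

import Mathlib

open scoped LinearAlgebra.Projectivization

noncomputable section

namespace RuledQuintic

/-- The projective space `PG(n, F)`. -/
abbrev PG (n : ℕ) (F : Type*) [Field F] : Type _ := ℙ F (Fin (n + 1) → F)

/-- The vector `(x^r, x^(r-1) y, …, x y^(r-1), y^r)`. -/
def momentVec {F : Type*} [Field F] (r : ℕ) (v : Fin 2 → F) : Fin (r + 1) → F :=
  fun i => v 0 ^ (r - (i : ℕ)) * v 1 ^ (i : ℕ)

theorem momentVec_ne_zero {F : Type*} [Field F] (r : ℕ) {v : Fin 2 → F} (hv : v ≠ 0) :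
    momentVec r v ≠ 0 := by
  intro h
  apply hv
  have h0 := congrFun h 0
  have h1 := congrFun h (Fin.last r)
  simp only [momentVec, Fin.val_zero, Nat.sub_zero, pow_zero, mul_one, Pi.zero_apply,
    Fin.val_last, Nat.sub_self, one_mul] at h0 h1
  ext i
  fin_cases i
  · exact eq_zero_of_pow_eq_zero h0
  · exact eq_zero_of_pow_eq_zero h1

theorem momentVec_smul {F : Type*} [Field F] (r : ℕ) (a : F) (v : Fin 2 → F) :
    momentVec r (a • v) = a ^ r • momentVec r v := by
  ext i
  have hi : (i : ℕ) ≤ r := Nat.lt_succ_iff.mp i.isLt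
  simp only [momentVec, Pi.smul_apply, smul_eq_mul, mul_pow]
  have ha : a ^ r = a ^ (r - (i : ℕ)) * a ^ (i : ℕ) := by
    rw [← pow_add, Nat.sub_add_cancel hi]
  rw [ha]
  ring

/-- The standard normal rational curve of `PG(r, F)`, parametrised by the projective line:
`(x, y) ↦ (x^r, x^(r-1) y, …, y^r)`; so `(1, θ) ↦ (1, θ, …, θ^r)` and
`∞ = (0, 1) ↦ (0, …, 0, 1)`. -/
def momentCurve (F : Type*) [Field F] (r : ℕ) : PG 1 F → PG r F :=
  Projectivization.lift
    (fun v : { v : Fin 2 → F // v ≠ 0 } =>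
      Projectivization.mk F (momentVec r v.1) (momentVec_ne_zero r v.2))
    (by
      rintro ⟨a, ha⟩ ⟨b, hb⟩ t (h : a = t • b)
      refine (Projectivization.mk_eq_mk_iff' F _ _ _ _).mpr ⟨t ^ r, ?_⟩
      show t ^ r • momentVec r b = momentVec r a
      rw [h, momentVec_smul])

/-- `γ` parametrises the point set `N` of `PG(n, F)` as a normal rational curve that generates an
`r`-dimensional subspace: after a choice of a frame of that subspace (an injective linear map from
`F^(r+1)`), the curve `γ` is `(x, y) ↦ (x^r, x^(r-1) y, …, y^r)`, and `N` is its set of points. -/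
def IsNRCParam {F : Type*} [Field F] {n : ℕ} (r : ℕ) (γ : PG 1 F → PG n F)
    (N : Set (PG n F)) : Prop :=
  (∃ (T : (Fin (r + 1) → F) →ₗ[F] (Fin (n + 1) → F)) (hT : Function.Injective T),
    ∀ θ, γ θ = Projectivization.map T hT (momentCurve F r θ)) ∧
  Set.range γ = N

/-- `N` is an `r`-dimensional normal rational curve of `PG(n, F)`. For `r = 2` these are the
non-degenerate conics, for `r = 3` the twisted cubics. -/
def IsNRC {F : Type*} [Field F] {n : ℕ} (r : ℕ) (N : Set (PG n F)) : Prop :=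
  ∃ γ : PG 1 F → PG n F, IsNRCParam r γ N

/-- `φ` is a projectivity from the points of the `r`-dimensional normal rational curve `C` to the
points of the `s`-dimensional normal rational curve `N`: in terms of the parameters of `C` and `N`
it is an element of `PGL(2, F)`. -/
def IsProjectivity {F : Type*} [Field F] {n : ℕ} (r s : ℕ) {C N : Set (PG n F)}
    (φ : C → N) : Prop :=
  ∃ γ δ : PG 1 F → PG n F, IsNRCParam r γ C ∧ IsNRCParam s δ N ∧
    ∃ g : (Fin 2 → F) ≃ₗ[F] (Fin 2 → F), ∀ (P : C) (θ : PG 1 F), γ θ = P →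
      (φ P : PG n F) = δ (Projectivization.map g.toLinearMap g.injective θ)

/-- A scroll of `PG(6, F)` that rules a non-degenerate conic and a twisted cubic, lying in a plane
and a 3-space that are disjoint, according to a projectivity. -/
structure Scroll (F : Type*) [Field F] where
  /-- the conic directrix -/
  C : Set (PG 6 F)
  /-- the twisted cubic directrix -/
  N₃ : Set (PG 6 F)
  isConic : IsNRC 2 C
  isTwistedCubic : IsNRC 3 N₃
  disjoint : Disjoint (Projectivization.Subspace.span C) (Projectivization.Subspace.span N₃)
  /-- the projectivity that rules the scroll -/
  φ : C → N₃
  isProjectivity : IsProjectivity 2 3 φ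

/-- The generator of the scroll through the point `P` of the conic directrix: the line joining
`P` and `φ P`. -/
def Scroll.generator {F : Type*} [Field F] (V : Scroll F) (P : V.C) : Set (PG 6 F) :=
  (Projectivization.Subspace.span {(P : PG 6 F), (V.φ P : PG 6 F)} : Set (PG 6 F))

/-- The point set of the scroll: the union of its generators. -/
def Scroll.points {F : Type*} [Field F] (V : Scroll F) : Set (PG 6 F) :=
  ⋃ P : V.C, V.generator P

end RuledQuintic

end

namespace RuledQuintic

/-! It suffices that each generator carries at most one point of the curve: sending a point of the
curve to a generator through it is then injective between two sets of `q + 1` elements, hence onto.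

Suppose two points lie on one generator, placed at `t = 0`. They span it, so a functional `L`
vanishing on the curve kills `a₀` and `b₀`, and `L` restricted to the generator at `(s, t)` is
divisible by `t`. Replacing the factor `t` by `s` is composing `L` with `shift`, so `L ∘ shift`
vanishes at every point of the curve off that generator, that is, at all but two. A form of degree
`r` with `q - 1 > r` zeros is zero, so `L ∘ shift` vanishes on the whole curve and the argument
repeats. After three shifts `L` has killed all `aᵢ` and `bⱼ`, so `L = 0` and the curve spans `PG(6,
q)`, although `r ≤ 5` (`det_eq_zero_of_mem_span`). -/

open Polynomial in
/-- A form of degree `r` that vanishes at all points of the projective line except possibly two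
is zero, if the field has at least `r + 2` elements. -/
theorem linearMap_eq_zero_of_momentVec {F : Type*} [Field F] [Finite F] {r : ℕ}
    (hr : r + 2 ≤ Nat.card F) (c : (Fin (r + 1) → F) →ₗ[F] F) {p q : Fin 2 → F}
    (hp : p ≠ 0) (hq : q ≠ 0)
    (h : ∀ v : Fin 2 → F, v 0 * p 1 - v 1 * p 0 ≠ 0 → v 0 * q 1 - v 1 * q 0 ≠ 0 →
      c (momentVec r v) = 0) : c = 0 := by
  classical
  have := Fintype.ofFinite F
  rw [Nat.card_eq_fintype_card] at hr
  have hc : ∀ v, c v = ∑ i, v i * c (Pi.single i 1) := fun v => by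
    conv_lhs => rw [← Finset.univ_sum_single v, map_sum]
    refine Finset.sum_congr rfl fun i _ => ?_
    rw [← smul_eq_mul, ← map_smul, ← Pi.single_smul', smul_eq_mul, mul_one]
  set P : F[X] := ∑ i : Fin (r + 1), C (c (Pi.single i 1)) * X ^ (i : ℕ) with hP
  have hPd : P.natDegree ≤ r := natDegree_sum_le_of_forall_le _ _ fun i _ =>
    (natDegree_C_mul_X_pow_le _ _).trans (Nat.lt_succ_iff.mp i.isLt)
  have hPc : ∀ i : Fin (r + 1), P.coeff i = c (Pi.single i 1) := fun i => by
    simp [hP, finsetSum_coeff, coeff_C_mul, coeff_X_pow, Fin.val_inj]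
  -- At `x` this is the determinant of `(1, x)` and `u`; the factors `l p` and `l q` absorb the two
  -- exceptional points.
  let l : (Fin 2 → F) → F[X] := fun u => C (- u 0) * X + C (u 1)
  have hld : ∀ u, (l u).natDegree ≤ 1 := fun u => natDegree_linear_le
  have hl1 : ∀ u, (l u).coeff 1 = - u 0 := fun u => by simp [l]
  have hl0 : ∀ u, u ≠ 0 → l u ≠ 0 := fun u hu h0 => hu <| by
    have e0 : (l u).coeff 0 = u 1 := by simp [l]
    have e1 := hl1 u
    rw [h0, coeff_zero] at e0 e1
    ext i
    fin_cases i
    · simpa using e1.symm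
    · exact e0.symm
  have key : ∀ v : Fin 2 → F,
      c (momentVec r v) * (v 0 * p 1 - v 1 * p 0) * (v 0 * q 1 - v 1 * q 0) = 0 := fun v => by
    by_cases h1 : v 0 * p 1 - v 1 * p 0 = 0
    · simp [h1]
    by_cases h2 : v 0 * q 1 - v 1 * q 0 = 0
    · simp [h2]
    simp [h v h1 h2]
  have hPl : (P * l p).natDegree ≤ r + 1 := natDegree_mul_le.trans (add_le_add hPd (hld p))
  have hPll : (P * l p * l q).natDegree ≤ r + 1 + 1 :=
    natDegree_mul_le.trans (add_le_add hPl (hld q))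
  -- The top coefficient is the value of the product form at infinity, `(0, 1)`. Its vanishing
  -- lowers the degree below `r + 2 ≤ q`, so the `q` affine zeros suffice.
  have htop : (P * l p * l q).coeff (r + 1 + 1) = 0 := by
    rw [coeff_mul_add_eq_of_natDegree_le hPl (hld q), coeff_mul_add_eq_of_natDegree_le hPd (hld p), hl1, hl1]
    have h1 := hPc (Fin.last r)
    rw [Fin.val_last] at h1
    rw [h1]
    have h2 := key ![0, 1]
    have h3 : momentVec r ![(0 : F), 1] = Pi.single (Fin.last r) 1 := by
      ext i
      by_cases hi : i = Fin.last r
      · subst hi; simp [momentVec]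
      · have : r - (i : ℕ) ≠ 0 := by
          have := Fin.val_lt_last hi
          omega
        simp [momentVec, hi, this]
    rw [h3] at h2
    simpa using h2
  have hzero : P * l p * l q = 0 := by
    by_contra hne
    refine hne (eq_zero_of_natDegree_lt_card_of_eval_eq_zero _ (f := (id : F → F))
      Function.injective_id (fun x => ?_) (lt_of_lt_of_le (lt_of_le_of_ne hPll fun h => ?_) hr))
    · have h2 := key ![1, x]
      rw [hc] at h2
      have h3 : P.eval x = ∑ i, momentVec r ![1, x] i * c (Pi.single i 1) := by
        rw [hP, eval_finsetSum]
        refine Finset.sum_congr rfl fun i _ => ?_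
        rw [eval_C_mul, eval_X_pow, mul_comm]
        simp [momentVec]
      rw [← h3] at h2
      simp only [id, eval_mul, l, eval_add, eval_C, eval_X]
      simp only [Matrix.cons_val_zero, Matrix.cons_val_one] at h2
      linear_combination h2
    · rw [← h] at htop
      exact hne (leadingCoeff_eq_zero.mp htop)
  have hP0 : P = 0 := by
    simpa [hl0 p hp, hl0 q hq] using hzero
  ext i
  simpa [hP0] using (hPc i).symm

theorem span_momentVec {F : Type*} [Field F] [Finite F] {r : ℕ} (hr : r + 2 ≤ Nat.card F) :
    Submodule.span F (momentVec r '' {v : Fin 2 → F | v ≠ 0}) = ⊤ := by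
  by_contra hne
  obtain ⟨c, hc, hle⟩ := Submodule.exists_le_ker_of_lt_top _ (lt_top_iff_ne_top.mpr hne)
  have h1 : (![1, 0] : Fin 2 → F) ≠ 0 := fun h => one_ne_zero (congrFun h 0)
  refine hc (linearMap_eq_zero_of_momentVec hr c h1 h1 fun v hv _ => ?_)
  refine hle (Submodule.subset_span ⟨v, ?_, rfl⟩)
  rintro rfl
  simp at hv

/-- Any three points of a normal rational curve are independent. -/
theorem det_mul_det_eq_zero_of_momentVec {F : Type*} [Field F] {r : ℕ}
    (hr : r = 3 ∨ r = 4 ∨ r = 5) {v p q : Fin 2 → F} (hv : v ≠ 0) {x y : F}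
    (h : momentVec r v = x • momentVec r p + y • momentVec r q) :
    (v 0 * p 1 - v 1 * p 0) * (v 0 * q 1 - v 1 * q 0) = 0 := by
  have h' : ∀ i : Fin (r + 1), v 0 ^ (r - (i : ℕ)) * v 1 ^ (i : ℕ) =
      x * (p 0 ^ (r - (i : ℕ)) * p 1 ^ (i : ℕ)) + y * (q 0 ^ (r - (i : ℕ)) * q 1 ^ (i : ℕ)) :=
    fun i => congrFun h i
  obtain ⟨n, rfl⟩ : ∃ n, r = n + 2 := ⟨r - 2, by omega⟩
  have h0 := h' ⟨0, by omega⟩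
  have h1 := h' ⟨1, by omega⟩
  have h2 := h' ⟨2, by omega⟩
  have g0 := h' ⟨n, by omega⟩
  have g1 := h' ⟨n + 1, by omega⟩
  have g2 := h' ⟨n + 2, by omega⟩
  simp only [Nat.sub_zero, pow_zero, mul_one, pow_one, Nat.add_sub_cancel_left, Nat.sub_self,
    Nat.add_sub_cancel, one_mul, show n + 2 - 1 = n + 1 by omega,
    show n + 2 - (n + 1) = 1 by omega] at h0 h1 h2 g0 g1 g2
  -- The quadratic form with roots `p` and `q`, times a power of one coordinate, has degree `r` and
  -- vanishes at `p` and `q`, hence on their span.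
  have e0 : v 0 ^ n * ((v 0 * p 1 - v 1 * p 0) * (v 0 * q 1 - v 1 * q 0)) = 0 := by
    linear_combination (p 1 * q 1) * h0 - (p 1 * q 0 + p 0 * q 1) * h1 + (p 0 * q 0) * h2
  have e1 : v 1 ^ n * ((v 0 * p 1 - v 1 * p 0) * (v 0 * q 1 - v 1 * q 0)) = 0 := by
    linear_combination (p 1 * q 1) * g0 - (p 1 * q 0 + p 0 * q 1) * g1 + (p 0 * q 0) * g2
  by_contra hne
  refine hv ?_
  ext i
  fin_cases i
  · exact eq_zero_of_pow_eq_zero ((mul_eq_zero.mp e0).resolve_right hne)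
  · exact eq_zero_of_pow_eq_zero ((mul_eq_zero.mp e1).resolve_right hne)

/-! ### Coordinates adapted to one generator -/

/-- The basis `u, w` moves the chosen generator to `t = 0`, so only the vector at index `0` needs
identifying. Coefficients 2 and 3 may vanish in `F`; independence is later deduced from spanning. -/
theorem exists_momentVec_two_expansion {F : Type*} [Field F] (u w : Fin 2 → F) :
    ∃ a : Fin 3 → Fin 3 → F, a 0 = momentVec 2 u ∧ ∀ s t : F,
      momentVec 2 (s • u + t • w) = s ^ 2 • a 0 + (s * t) • a 1 + t ^ 2 • a 2 := by
  refine ⟨![momentVec 2 u, ![2 * u 0 * w 0, u 0 * w 1 + u 1 * w 0, 2 * u 1 * w 1],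
    momentVec 2 w], rfl, fun s t => ?_⟩
  ext i
  fin_cases i <;> simp [momentVec, Matrix.vecHead, Matrix.vecTail] <;> ring

theorem exists_momentVec_three_expansion {F : Type*} [Field F] (u w : Fin 2 → F) :
    ∃ b : Fin 4 → Fin 4 → F, b 0 = momentVec 3 u ∧ ∀ s t : F,
      momentVec 3 (s • u + t • w) =
        s ^ 3 • b 0 + (s ^ 2 * t) • b 1 + (s * t ^ 2) • b 2 + t ^ 3 • b 3 := by
  refine ⟨![momentVec 3 u,
    ![3 * u 0 ^ 2 * w 0, u 0 ^ 2 * w 1 + 2 * u 0 * u 1 * w 0,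
      2 * u 0 * u 1 * w 1 + u 1 ^ 2 * w 0, 3 * u 1 ^ 2 * w 1],
    ![3 * u 0 * w 0 ^ 2, 2 * u 0 * w 0 * w 1 + u 1 * w 0 ^ 2,
      u 0 * w 1 ^ 2 + 2 * u 1 * w 0 * w 1, 3 * u 1 * w 1 ^ 2],
    momentVec 3 w], rfl, fun s t => ?_⟩
  ext i
  fin_cases i <;> simp [momentVec, Matrix.vecHead, Matrix.vecTail] <;> ring

/-- The shift `a₀ ↦ a₁ ↦ a₂ ↦ 0`, `b₀ ↦ b₁ ↦ b₂ ↦ b₃ ↦ 0` of a basis. -/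
noncomputable def shift {F E : Type*} [Field F] [AddCommGroup E] [Module F E]
    (B : Module.Basis (Fin 3 ⊕ Fin 4) F E) : E →ₗ[F] E :=
  B.constr F (Sum.elim ![B (.inl 1), B (.inl 2), 0] ![B (.inr 1), B (.inr 2), B (.inr 3), 0])

/-- A normal rational curve on the scroll has at most one point on the generator with
parameter `s = 1, t = 0`. -/
theorem det_eq_zero_of_mem_span {F E : Type*} [Field F] [Finite F] (hq : 7 ≤ Nat.card F)
    [AddCommGroup E] [Module F E] (B : Module.Basis (Fin 3 ⊕ Fin 4) F E)
    {r : ℕ} (hr : r = 3 ∨ r = 4 ∨ r = 5) (T : (Fin (r + 1) → F) →ₗ[F] E)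
    (hT : Function.Injective T)
    (hN : ∀ v : Fin 2 → F, v ≠ 0 → ∃ s t x y : F, T (momentVec r v) =
      x • (s ^ 2 • B (.inl 0) + (s * t) • B (.inl 1) + t ^ 2 • B (.inl 2)) +
      y • (s ^ 3 • B (.inr 0) + (s ^ 2 * t) • B (.inr 1) + (s * t ^ 2) • B (.inr 2) +
        t ^ 3 • B (.inr 3)))
    {p q : Fin 2 → F} (hp0 : p ≠ 0) (hq0 : q ≠ 0)
    (hp : T (momentVec r p) ∈ Submodule.span F {B (.inl 0), B (.inr 0)})
    (hq : T (momentVec r q) ∈ Submodule.span F {B (.inl 0), B (.inr 0)}) :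
    p 0 * q 1 - p 1 * q 0 = 0 := by
  by_contra hpq
  have hspan : Submodule.span F {B (.inl 0), B (.inr 0)} ≤
      Submodule.span F {T (momentVec r p), T (momentVec r q)} := by
    have hle : Submodule.span F {T (momentVec r p), T (momentVec r q)} ≤
        Submodule.span F {B (.inl 0), B (.inr 0)} :=
      Submodule.span_le.mpr (by rintro _ (rfl | rfl) <;> assumption)
    have hli : LinearIndependent F ![T (momentVec r p), T (momentVec r q)] := by
      refine LinearIndependent.pair_iff.mpr fun x y hxy => ?_
      have hxy' : x • momentVec r p + y • momentVec r q = 0 := hT (by simpa using hxy)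
      have hx : x = 0 := by
        by_contra hx
        have h1 : momentVec r p = (-(x⁻¹ * y)) • momentVec r q + (0 : F) • momentVec r q := by
          rw [zero_smul, add_zero, neg_smul, mul_smul, ← smul_neg,
            ← eq_neg_of_add_eq_zero_left hxy', inv_smul_smul₀ hx]
        exact mul_ne_zero hpq hpq (det_mul_det_eq_zero_of_momentVec hr hp0 h1)
      refine ⟨hx, ?_⟩
      rw [hx, zero_smul, zero_add] at hxy'
      exact (smul_eq_zero.mp hxy').resolve_right (momentVec_ne_zero r hq0)
    have hfin := finrank_span_eq_card hli
    rw [Matrix.range_cons_cons_empty, Fintype.card_fin] at hfin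
    have hfd := FiniteDimensional.span_of_finite F (Set.toFinite {B (.inl 0), B (.inr 0)})
    refine (Submodule.eq_of_le_of_finrank_le hle ?_).ge
    rw [hfin]
    classical
    have := finrank_span_finset_le_card (R := F) ({B (.inl 0), B (.inr 0)} : Finset E)
    rw [Finset.coe_pair] at this
    exact this.trans Finset.card_le_two
  have hkill : ∀ L : E →ₗ[F] F, L ∘ₗ T = 0 → L (B (.inl 0)) = 0 ∧ L (B (.inr 0)) = 0 := by
    intro L hL
    have hL0 : ∀ z ∈ Submodule.span F {B (.inl 0), B (.inr 0)}, L z = 0 := fun z hz => by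
      obtain ⟨x, y, rfl⟩ := Submodule.mem_span_pair.mp (hspan hz)
      have hLT : ∀ v, L (T v) = 0 := fun v => LinearMap.congr_fun hL v
      simp [hLT]
    exact ⟨hL0 _ (Submodule.subset_span (by simp)), hL0 _ (Submodule.subset_span (by simp))⟩
  -- At a point `z` of the curve, `t * L (shift z) = s * L z = 0`. If `t = 0`, then `z` is a third
  -- curve point on the line through those of `p` and `q`, which is impossible.
  have hstep : ∀ L : E →ₗ[F] F, L ∘ₗ T = 0 → (L ∘ₗ shift B) ∘ₗ T = 0 := by
    intro L hL
    have hLT : ∀ v, L (T v) = 0 := fun v => LinearMap.congr_fun hL v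
    obtain ⟨ha, hb⟩ := hkill L hL
    refine linearMap_eq_zero_of_momentVec (by omega) _ hp0 hq0 fun v hvp hvq => ?_
    have hv : v ≠ 0 := by
      rintro rfl
      simp at hvp
    obtain ⟨s, t, x, y, h⟩ := hN v hv
    by_cases ht : t = 0
    · have hmem : T (momentVec r v) ∈ Submodule.span F {B (.inl 0), B (.inr 0)} := by
        refine Submodule.mem_span_pair.mpr ⟨x * s ^ 2, y * s ^ 3, ?_⟩
        simp [h, ht, mul_smul]
      obtain ⟨c, d, hcd⟩ := Submodule.mem_span_pair.mp (hspan hmem)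
      have hv' : momentVec r v = c • momentVec r p + d • momentVec r q :=
        hT (by simpa using hcd.symm)
      exact absurd (det_mul_det_eq_zero_of_momentVec hr hv hv') (mul_ne_zero hvp hvq)
    · have h0 := hLT (momentVec r v)
      refine (mul_eq_zero.mp (?_ : t * _ = 0)).resolve_left ht
      rw [h] at h0
      simp only [LinearMap.comp_apply, h, map_add, map_smul, smul_eq_mul, ha, hb, shift,
        Module.Basis.constr_basis, Sum.elim_inl, Sum.elim_inr, Matrix.cons_val, map_zero] at h0 ⊢
      linear_combination s * h0
  have hzero : ∀ L : E →ₗ[F] F, L ∘ₗ T = 0 → L = 0 := by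
    intro L hL
    have h0 := hkill L hL
    have hL1 := hstep L hL
    have h1 := hkill _ hL1
    have hL2 := hstep _ hL1
    have h2 := hkill _ hL2
    have h3 := hkill _ (hstep _ hL2)
    simp only [LinearMap.comp_apply, shift, Module.Basis.constr_basis, Sum.elim_inl,
      Sum.elim_inr, Matrix.cons_val] at h1 h2 h3
    refine B.ext ?_
    rintro (i | i)
    · fin_cases i
      exacts [h0.1, h1.1, h2.1]
    · fin_cases i
      exacts [h0.2, h1.2, h2.2, h3.2]
  have hsurj : LinearMap.range T = ⊤ := by
    by_contra hne
    obtain ⟨L, hL, hle⟩ := Submodule.exists_le_ker_of_lt_top _ (lt_top_iff_ne_top.mpr hne)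
    exact hL (hzero L (LinearMap.ext fun v => hle ⟨v, rfl⟩))
  have h1 := LinearMap.finrank_range_of_inj hT
  rw [hsurj, finrank_top, Module.finrank_eq_card_basis B, Module.finrank_fin_fun] at h1
  simp at h1
  omega

/-! ### From projective points to vectors -/

theorem mem_span_pair_of_mk_mem {F E : Type*} [Field F] [AddCommGroup E] [Module F E]
    {z a b : E} (hz : z ≠ 0) (ha : a ≠ 0) (hb : b ≠ 0)
    (h : Projectivization.mk F z hz ∈ Projectivization.Subspace.span
      {Projectivization.mk F a ha, Projectivization.mk F b hb}) :
    z ∈ Submodule.span F {a, b} := by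
  rw [← Submodule.mk_mem_projectivization_iff _ hz]
  refine Projectivization.Subspace.span_le_subspace_iff.mpr ?_ h
  rintro _ (rfl | rfl)
  · exact (Submodule.mk_mem_projectivization_iff _ ha).mpr (Submodule.subset_span (by simp))
  · exact (Submodule.mk_mem_projectivization_iff _ hb).mpr (Submodule.subset_span (by simp))

theorem ne_zero_of_momentVec {F : Type*} [Field F] {n r : ℕ}
    {T : (Fin (r + 1) → F) →ₗ[F] (Fin (n + 1) → F)} (hT : Function.Injective T)
    {v : Fin 2 → F} (hv : v ≠ 0) : T (momentVec r v) ≠ 0 :=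
  (map_ne_zero_iff T hT).mpr (momentVec_ne_zero r hv)

theorem map_momentCurve_mk {F : Type*} [Field F] {n r : ℕ}
    {T : (Fin (r + 1) → F) →ₗ[F] (Fin (n + 1) → F)} (hT : Function.Injective T)
    {v : Fin 2 → F} (hv : v ≠ 0) :
    Projectivization.map T hT (momentCurve F r (Projectivization.mk F v hv)) =
      Projectivization.mk F (T (momentVec r v)) (ne_zero_of_momentVec hT hv) :=
  rfl

/-- The vectors of the subspace spanned by a normal rational curve. -/
theorem range_le_submodule_span {F : Type*} [Field F] [Finite F] {n r : ℕ}
    (hr : r + 2 ≤ Nat.card F) {γ : PG 1 F → PG n F} {N : Set (PG n F)}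
    (hN : Set.range γ = N)
    {T : (Fin (r + 1) → F) →ₗ[F] (Fin (n + 1) → F)} (hT : Function.Injective T)
    (hγ : ∀ θ, γ θ = Projectivization.map T hT (momentCurve F r θ)) :
    LinearMap.range T ≤
      Projectivization.Subspace.submodule (Projectivization.Subspace.span N) := by
  rw [LinearMap.range_eq_map, ← span_momentVec hr, Submodule.map_le_iff_le_comap,
    Submodule.span_le]
  rintro _ ⟨v, hv, rfl⟩
  have hne := ne_zero_of_momentVec hT hv
  refine (Projectivization.Subspace.mem_submodule_iff _ hne).mpr
    (Projectivization.Subspace.subset_span _ ?_)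
  rw [← hN, ← map_momentCurve_mk hT hv, ← hγ]
  exact ⟨_, rfl⟩

theorem mk_eq_mk_of_det {F : Type*} [Field F] {p q : Fin 2 → F} (hp : p ≠ 0) (hq : q ≠ 0)
    (h : p 0 * q 1 - p 1 * q 0 = 0) :
    Projectivization.mk F p hp = Projectivization.mk F q hq := by
  rw [Projectivization.mk_eq_mk_iff']
  by_cases h0 : q 0 = 0
  · have h1 : q 1 ≠ 0 := fun h1 => hq (by ext i; fin_cases i <;> assumption)
    refine ⟨p 1 / q 1, ?_⟩
    have hp0 : p 0 = 0 := by simpa [h0, h1] using h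
    ext i
    fin_cases i
    · simp [h0, hp0]
    · simp [h1]
  · refine ⟨p 0 / q 0, ?_⟩
    ext i
    fin_cases i
    · simp [h0]
    · simp
      field_simp
      linear_combination h

theorem injective_of_isNRCParam {F : Type*} [Field F] {n r : ℕ} (hr : r = 3 ∨ r = 4 ∨ r = 5)
    {γ : PG 1 F → PG n F} {N : Set (PG n F)} (h : IsNRCParam r γ N) :
    Function.Injective γ := by
  obtain ⟨⟨T, hT, hγ⟩, -⟩ := h
  intro θ θ' he
  induction θ using Projectivization.ind with | h v hv => ?_
  induction θ' using Projectivization.ind with | h w hw => ?_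
  rw [hγ, hγ, map_momentCurve_mk, map_momentCurve_mk, Projectivization.mk_eq_mk_iff'] at he
  obtain ⟨a, ha⟩ := he
  have h1 : momentVec r v = a • momentVec r w + (0 : F) • momentVec r w := by
    refine hT ?_
    simp [ha]
  exact mk_eq_mk_of_det hv hw (mul_self_eq_zero.mp (det_mul_det_eq_zero_of_momentVec hr hv h1))

/-- 6 is not a prime power; 7 is what the zero count `r + 2 ≤ q` needs at `r = 5`. -/
theorem seven_le_card {F : Type*} [Field F] [Finite F] (hq : 6 ≤ Nat.card F) :
    7 ≤ Nat.card F := by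
  have := Fintype.ofFinite F
  refine lt_of_le_of_ne hq fun h => ?_
  have h1 := FiniteField.isPrimePow_card F
  rw [← Nat.card_eq_fintype_card, ← h, isPrimePow_iff_unique_prime_dvd] at h1
  obtain ⟨p, -, hp⟩ := h1
  have h2 := hp 2 ⟨Nat.prime_two, by norm_num⟩
  have h3 := hp 3 ⟨Nat.prime_three, by norm_num⟩
  omega

/-! ### At most one point on each generator -/

/-- A normal rational curve on the scroll has at most one point on each generator. -/
theorem eq_of_mem_generator {F : Type*} [Field F] [Finite F] (hq : 7 ≤ Nat.card F)
    (V : Scroll F) {r : ℕ} (hr : r = 3 ∨ r = 4 ∨ r = 5) {N : Set (PG 6 F)} (hN : IsNRC r N)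
    (hNV : N ⊆ V.points) (P : V.C) {Q Q' : PG 6 F} (hQ : Q ∈ N) (hQP : Q ∈ V.generator P)
    (hQ' : Q' ∈ N) (hQP' : Q' ∈ V.generator P) : Q = Q' := by
  obtain ⟨ν, ⟨T, hT, hν⟩, hνN⟩ := hN
  obtain ⟨γ, δ, ⟨⟨T₂, hT₂, hγ⟩, hγC⟩, ⟨⟨T₃, hT₃, hδ⟩, hδN⟩, g, hφ⟩ := V.isProjectivity
  have hgen : ∀ (P : V.C) (w : Fin 2 → F) (hw : w ≠ 0), γ (Projectivization.mk F w hw) = P →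
      ∀ (z : Fin 7 → F) (hz : z ≠ 0), Projectivization.mk F z hz ∈ V.generator P →
      z ∈ Submodule.span F {T₂ (momentVec 2 w), T₃ (momentVec 3 (g w))} := by
    intro P w hw hP z hz hzP
    have hgw : g w ≠ 0 := (map_ne_zero_iff g g.injective).mpr hw
    refine mem_span_pair_of_mk_mem hz (ne_zero_of_momentVec hT₂ hw)
      (ne_zero_of_momentVec hT₃ hgw) ?_
    have h1 := hφ P _ hP
    rw [hδ, Projectivization.map_mk] at h1
    rw [hγ] at hP
    rw [← map_momentCurve_mk hT₂ hw, ← map_momentCurve_mk hT₃ hgw, hP]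
    unfold Scroll.generator at hzP
    rw [h1] at hzP
    exact hzP
  obtain ⟨θ, hθ⟩ : (P : PG 6 F) ∈ Set.range γ := hγC.symm ▸ P.2
  induction θ using Projectivization.ind with | h p hp => ?_
  obtain ⟨p', hpp'⟩ : ∃ p' : Fin 2 → F, p 0 * p' 1 - p 1 * p' 0 ≠ 0 := by
    by_contra! hall
    refine hp ?_
    ext i
    fin_cases i
    · simpa using hall ![0, 1]
    · simpa using hall ![1, 0]
  have hexp : ∀ w : Fin 2 → F, ∃ s t : F, w = s • p + t • p' := by
    intro w
    refine ⟨(w 0 * p' 1 - w 1 * p' 0) / (p 0 * p' 1 - p 1 * p' 0),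
      (p 0 * w 1 - p 1 * w 0) / (p 0 * p' 1 - p 1 * p' 0), ?_⟩
    ext i
    fin_cases i
    · simp only [Fin.zero_eta, Pi.add_apply, Pi.smul_apply, smul_eq_mul]
      rw [div_mul_eq_mul_div, div_mul_eq_mul_div, ← add_div, eq_div_iff hpp']
      ring
    · simp only [Fin.mk_one, Pi.add_apply, Pi.smul_apply, smul_eq_mul]
      rw [div_mul_eq_mul_div, div_mul_eq_mul_div, ← add_div, eq_div_iff hpp']
      ring
  obtain ⟨a, ha0, ha⟩ := exists_momentVec_two_expansion p p'
  obtain ⟨b, hb0, hb⟩ := exists_momentVec_three_expansion (g p) (g p')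
  have hb' : ∀ s t : F, momentVec 3 (g (s • p + t • p')) =
      s ^ 3 • b 0 + (s ^ 2 * t) • b 1 + (s * t ^ 2) • b 2 + t ^ 3 • b 3 := fun s t => by
    rw [map_add, map_smul, map_smul, hb]
  have hdisj : Disjoint (LinearMap.range T₂) (LinearMap.range T₃) := by
    refine Disjoint.mono (range_le_submodule_span (by omega) hγC hT₂ hγ)
      (range_le_submodule_span (by omega) hδN hT₃ hδ) ?_
    exact V.disjoint.map_orderIso Projectivization.Subspace.submodule
  -- Disjoint subspaces of dimensions 3 and 4 fill the 7-dimensional space; the seven coefficient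
  -- vectors span it and so form a basis.
  have hsup : LinearMap.range T₂ ⊔ LinearMap.range T₃ = ⊤ := by
    refine Submodule.eq_top_of_disjoint _ _ ?_ hdisj
    rw [LinearMap.finrank_range_of_inj hT₂, LinearMap.finrank_range_of_inj hT₃]
    simp
  let e : Fin 3 ⊕ Fin 4 → (Fin 7 → F) := Sum.elim (fun i => T₂ (a i)) (fun i => T₃ (b i))
  have hspan : ⊤ ≤ Submodule.span F (Set.range e) := by
    have hea : ∀ i, T₂ (a i) ∈ Submodule.span F (Set.range e) := fun i =>
      Submodule.subset_span ⟨.inl i, rfl⟩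
    have heb : ∀ i, T₃ (b i) ∈ Submodule.span F (Set.range e) := fun i =>
      Submodule.subset_span ⟨.inr i, rfl⟩
    rw [← hsup, sup_le_iff]
    constructor
    · rw [LinearMap.range_eq_map, ← span_momentVec (by omega : 2 + 2 ≤ Nat.card F),
        Submodule.map_le_iff_le_comap, Submodule.span_le]
      rintro _ ⟨w, -, rfl⟩
      obtain ⟨s, t, rfl⟩ := hexp w
      rw [ha]
      simp only [SetLike.mem_coe, Submodule.mem_comap, map_add, map_smul]
      exact Submodule.add_mem _ (Submodule.add_mem _ (Submodule.smul_mem _ _ (hea 0))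
        (Submodule.smul_mem _ _ (hea 1))) (Submodule.smul_mem _ _ (hea 2))
    · rw [LinearMap.range_eq_map, ← span_momentVec (by omega : 3 + 2 ≤ Nat.card F),
        Submodule.map_le_iff_le_comap, Submodule.span_le]
      rintro _ ⟨w, -, rfl⟩
      obtain ⟨s, t, h⟩ := hexp (g.symm w)
      have hw : w = g (s • p + t • p') := by rw [← h, g.apply_symm_apply]
      rw [hw, hb']
      simp only [SetLike.mem_coe, Submodule.mem_comap, map_add, map_smul]
      exact Submodule.add_mem _ (Submodule.add_mem _ (Submodule.add_mem _
        (Submodule.smul_mem _ _ (heb 0)) (Submodule.smul_mem _ _ (heb 1)))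
        (Submodule.smul_mem _ _ (heb 2))) (Submodule.smul_mem _ _ (heb 3))
  let B := basisOfTopLeSpanOfCardEqFinrank e hspan (by simp)
  have hBl : ∀ i, B (.inl i) = T₂ (a i) := fun i =>
    congrFun (coe_basisOfTopLeSpanOfCardEqFinrank e hspan (by simp)) (.inl i)
  have hBr : ∀ i, B (.inr i) = T₃ (b i) := fun i =>
    congrFun (coe_basisOfTopLeSpanOfCardEqFinrank e hspan (by simp)) (.inr i)
  rw [← hνN] at hQ hQ'
  obtain ⟨θ₁, rfl⟩ := hQ
  obtain ⟨θ₂, rfl⟩ := hQ'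
  induction θ₁ using Projectivization.ind with | h u hu => ?_
  induction θ₂ using Projectivization.ind with | h w hw => ?_
  rw [hν, map_momentCurve_mk hT] at hQP hQP'
  refine congrArg ν (mk_eq_mk_of_det hu hw ?_)
  refine det_eq_zero_of_mem_span hq B hr T hT (fun v hv => ?_) hu hw ?_ ?_
  · have hmem : Projectivization.mk F (T (momentVec r v)) (ne_zero_of_momentVec hT hv) ∈ N := by
      rw [← hνN, ← map_momentCurve_mk hT hv, ← hν]
      exact ⟨_, rfl⟩
    obtain ⟨P', hP'⟩ := Set.mem_iUnion.mp (hNV hmem)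
    obtain ⟨θ', hθ'⟩ : (P' : PG 6 F) ∈ Set.range γ := hγC.symm ▸ P'.2
    induction θ' using Projectivization.ind with | h z hz => ?_
    obtain ⟨x, y, hxy⟩ := Submodule.mem_span_pair.mp (hgen P' z hz hθ' _ _ hP')
    obtain ⟨s, t, rfl⟩ := hexp z
    refine ⟨s, t, x, y, ?_⟩
    rw [← hxy, ha, hb']
    simp only [hBl, hBr, map_add, map_smul]
  · rw [hBl, hBr, ha0, hb0]
    exact hgen P p hp hθ _ _ hQP
  · rw [hBl, hBr, ha0, hb0]
    exact hgen P p hp hθ _ _ hQP'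

end RuledQuintic

/-! ### Counting -/

theorem mainTheorem10 {F : Type*} [Field F] [Finite F] (hq : 6 ≤ Nat.card F)
    (V : RuledQuintic.Scroll F) (r : ℕ) (hr : r = 3 ∨ r = 4 ∨ r = 5)
    (N : Set (RuledQuintic.PG 6 F)) (hN : RuledQuintic.IsNRC r N) (hNV : N ⊆ V.points) :
    ∀ P : V.C, ∃! Q : RuledQuintic.PG 6 F, Q ∈ N ∧ Q ∈ V.generator P := by
  have huniq := fun (P : V.C) (Q Q' : RuledQuintic.PG 6 F) =>
    RuledQuintic.eq_of_mem_generator (Q := Q) (Q' := Q') (RuledQuintic.seven_le_card hq)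
      V hr hN hNV P
  have hgen : ∀ Q : N, ∃ P : V.C, (Q : RuledQuintic.PG 6 F) ∈ V.generator P :=
    fun Q => Set.mem_iUnion.mp (hNV Q.2)
  choose f hf using hgen
  have hinj : Function.Injective f := fun Q Q' h =>
    Subtype.ext (huniq (f Q) Q Q' Q.2 (hf Q) Q'.2 (h ▸ hf Q'))
  -- Both curves are images of the projective line; injectivity is needed only for the
  -- parametrisation of `N`.
  have hcard : Nat.card V.C ≤ Nat.card N := by
    obtain ⟨ν, hν⟩ := hN
    obtain ⟨γ, -, hγ⟩ := V.isConic
    rw [← hγ, ← hν.2, Nat.card_range_of_injective (RuledQuintic.injective_of_isNRCParam hr hν)]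
    exact Finite.card_range_le γ
  have hsurj : Function.Surjective f :=
    (hinj.bijective_of_nat_card_le hcard).2
  intro P
  obtain ⟨Q, rfl⟩ := hsurj P
  exact ⟨Q, ⟨Q.2, hf Q⟩, fun Q' hQ' => huniq (f Q) Q' Q hQ'.1 hQ'.2 Q.2 (hf Q)⟩
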